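/- Let $n\ge 0$, $\Omega=\{1,\dots,n\}$, let $\lambda=(\lambda_1\ge\lambda_2\ge\cdots)$ be a partition of $n$ with $\lambda\ne(n)$, and let $G\le S_n$ be a permutation group on $\Omega$ with $G\ne A_n,S_n$. An ordered partition of type $(l_1,\dots,l_r)$ of a finite set $S$ is a sequence $(A_1,\dots,A_r)$ of pairwise disjoint sets with union $S$ and $|A_i|=l_i$. A group $H$ acting on $S$ is $(l_1,\dots,l_r)$-transitive on $S$ if for any two ordered partitions $(A_i)$, $(B_i)$ of $S$ of this type some $g\in H$ satisfies $A_ig=B_i$ for all $i$. The group $G$ is $\lambda$-transitive if it is so on $\Omega$, and $t$-homogeneous if it is transitive on the $t$-element subsets of $\Omega$. The pair $(G,\lambda)$ is standard if there is an integer $t$ with $0\le t\le n/2$ such that $\lambda=(n-t,k_1,\dots,k_{r-1})$ (so the largest part of $\lambda$ is $n-t$), $G$ is $t$-homogeneous, and the setwise stabiliser in $G$ of any $t$-element subset $T$ of $\Omega$ acts $(k_1,\dots,k_{r-1})$-transitively on $T$. Then $G$ is $\lambda$-transitive if and only if $(G,\lambda)$ is standard. Moreover, if $n\ne 6$, then $G$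 is $\lambda$-transitive if and only if $(G,\lambda)$ is standard with $t<n/2$. -/

import Mathlib

open scoped Pointwise

/-- The sequence `A = (A₁, …, Aᵣ)` is an ordered partition of the finite set `S` of type
`l = (l₁, …, lᵣ)`: the `Aᵢ` are pairwise disjoint with union `S`, and `|Aᵢ| = lᵢ`. -/
def IsOrderedPartition {α : Type*} [DecidableEq α] (S : Finset α) (l : List ℕ)
    (A : Fin l.length → Finset α) : Prop :=
  (∀ i, (A i).card = l.get i) ∧
    (∀ i j, i ≠ j → Disjoint (A i) (A j)) ∧
      Finset.univ.biUnion A = S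

/-- `H` acts `l`-transitively on the finite set `S`: any two ordered partitions of `S` of type `l`
are mapped to each other, part by part, by an element of `H`.
(Used when `H` leaves `S` invariant.) -/
def IsPartitionTransitiveOn {α : Type*} [DecidableEq α] (H : Subgroup (Equiv.Perm α))
    (S : Finset α) (l : List ℕ) : Prop :=
  ∀ A B : Fin l.length → Finset α, IsOrderedPartition S l A → IsOrderedPartition S l B →
    ∃ g ∈ H, ∀ i, g • A i = B i

/-- The parts of a partition `lam` of `n`, listed in non-increasing order. -/
def Nat.Partition.sortedParts {n : ℕ} (lam : n.Partition) : List ℕ :=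
  lam.parts.sort (· ≥ ·)

/-- The permutation group `G` of degree `n` is `lam`-transitive. -/
def IsPartitionTransitive {n : ℕ} (G : Subgroup (Equiv.Perm (Fin n))) (lam : n.Partition) : Prop :=
  IsPartitionTransitiveOn G Finset.univ lam.sortedParts

/-- `G` is `t`-homogeneous: it is transitive on the `t`-element subsets of `{1, …, n}`. -/
def IsHomogeneousGroup {n : ℕ} (G : Subgroup (Equiv.Perm (Fin n))) (t : ℕ) : Prop :=
  ∀ S T : Finset (Fin n), S.card = t → T.card = t → ∃ g ∈ G, g • S = T

/-- The setwise stabiliser in `G` of the finite set `T`. -/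
def setStabilizer {n : ℕ} (G : Subgroup (Equiv.Perm (Fin n))) (T : Finset (Fin n)) :
    Subgroup (Equiv.Perm (Fin n)) :=
  G ⊓ MulAction.stabilizer (Equiv.Perm (Fin n)) T

/-- The three conditions of standardness of `(G, lam)` for a given `t`, apart from the bound
on `t`: `G` is `t`-homogeneous, `lam = (n - t, k₁, …, kᵣ₋₁)`, and the stabiliser in `G` of a
`t`-set acts `(k₁, …, kᵣ₋₁)`-transitively on it. -/
def IsStandardAt {n : ℕ} (G : Subgroup (Equiv.Perm (Fin n))) (lam : n.Partition) (t : ℕ) : Prop :=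
  IsHomogeneousGroup G t ∧
    ∃ k : List ℕ, lam.sortedParts = (n - t) :: k ∧
      ∀ T : Finset (Fin n), T.card = t → IsPartitionTransitiveOn (setStabilizer G T) T k

/-- The pair `(G, lam)` is standard; the bound on `t` is `t ≤ n / 2`. -/
def IsStandard {n : ℕ} (G : Subgroup (Equiv.Perm (Fin n))) (lam : n.Partition) : Prop :=
  ∃ t : ℕ, 2 * t ≤ n ∧ IsStandardAt G lam t

/-- The pair `(G, lam)` is standard with the strict bound `t < n / 2`. -/
def IsStrictlyStandard {n : ℕ} (G : Subgroup (Equiv.Perm (Fin n))) (lam : n.Partition) : Prop :=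
  ∃ t : ℕ, 2 * t < n ∧ IsStandardAt G lam t

/-! Let a be the largest part. An ordered partition of Ω with an a-set in front is the same as an
(n-a)-set together with an ordered partition of that set. So λ-transitivity is equivalent to the
standardness conditions at t = n - a, and only the bound on t has content: a ≤ n/2 must force A_n ≤
G, except when n = 6 and a = 3 (where the 3-transitive group PGL(2,5) is a genuine exception).

λ-transitivity makes a Young subgroup Y of type λ transitive on the cosets of G, so |S_n : G|
divides |Y|, and no prime p > a divides the index (`IsPartitionTransitive.not_dvd_index`). Hence G
contains a p-cycle for every prime p with a < p ≤ n. For n ≥ 8 a sharpened Bertrand postulate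
supplies a prime with n/2 < p ≤ n - 3; the p-cycle makes G primitive, and Jordan's theorem gives A_n
≤ G. In degrees 3 to 6 a 3-cycle is available directly; in degree 7 a finite check extracts one from
a 5-cycle and a 7-cycle. -/

namespace Nat

/-! ### Primes between n/2 and n - 3. -/

theorem succ_pow_eight_le_two_pow {s : ℕ} (hs : 44 ≤ s) : (s + 1) ^ 8 ≤ 2 ^ s := by
  induction s, hs using Nat.le_induction with
  | base => norm_num
  | succ s hs ih =>
    -- The left side grows by a factor of at most (46/45)^8 < 2.
    have h : (s + 1 + 1) * 45 ≤ (s + 1) * 46 := by lia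
    have h' : (s + 1 + 1) ^ 8 * 45 ^ 8 ≤ ((s + 1) ^ 8 * 2) * 45 ^ 8 :=
      calc (s + 1 + 1) ^ 8 * 45 ^ 8 = ((s + 1 + 1) * 45) ^ 8 := (mul_pow _ _ _).symm
        _ ≤ ((s + 1) * 46) ^ 8 := by gcongr
        _ = (s + 1) ^ 8 * 46 ^ 8 := mul_pow _ _ _
        _ ≤ (s + 1) ^ 8 * (2 * 45 ^ 8) := by gcongr; norm_num
        _ = _ := by ring
    calc (s + 1 + 1) ^ 8 ≤ (s + 1) ^ 8 * 2 := Nat.le_of_mul_le_mul_right h' (by positivity)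
      _ ≤ 2 ^ s * 2 := by gcongr
      _ = 2 ^ (s + 1) := (pow_succ _ _).symm

/-- A form of `bertrand_main_inequality` with an additional factor `2 * n`. -/
theorem mul_pow_sqrt_succ_mul_four_pow_le {n : ℕ} (hn : 968 ≤ n) :
    n * (2 * n) ^ (sqrt (2 * n) + 1) * 4 ^ (2 * n / 3) ≤ 4 ^ n := by
  set s := sqrt (2 * n) with hs
  -- 968 = 44² / 2.
  have hs44 : 44 ≤ s := Nat.le_sqrt.mpr (by lia)
  have hlt : 2 * n ≤ (s + 1) ^ 2 := by
    have := Nat.lt_succ_sqrt (2 * n)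
    rw [← hs] at this
    nlinarith
  have hle : s * s ≤ 2 * n := Nat.sqrt_le (2 * n)
  -- The room left by 4^(2n/3) is 4^(n/3); cubing avoids the fractional exponent.
  have h1 : (n * (2 * n) ^ (s + 1)) ^ 3 ≤ 4 ^ n := by
    have h2 : (n * (2 * n) ^ (s + 1)) ^ 3 ≤ (s + 1) ^ (6 * (s + 2)) :=
      calc (n * (2 * n) ^ (s + 1)) ^ 3 ≤ ((s + 1) ^ 2 * ((s + 1) ^ 2) ^ (s + 1)) ^ 3 := by
            gcongr; lia
        _ = (s + 1) ^ (6 * (s + 2)) := by rw [← pow_succ', ← pow_mul, ← pow_mul]; congr 1; lia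
    have h3 : ((s + 1) ^ (6 * (s + 2))) ^ 8 ≤ (2 ^ (s * s)) ^ 8 :=
      calc ((s + 1) ^ (6 * (s + 2))) ^ 8 = ((s + 1) ^ 8) ^ (6 * (s + 2)) := by
            rw [← pow_mul, ← pow_mul, mul_comm]
        _ ≤ (2 ^ s) ^ (6 * (s + 2)) := Nat.pow_le_pow_left (succ_pow_eight_le_two_pow hs44) _
        _ = 2 ^ (s * (6 * (s + 2))) := (pow_mul _ _ _).symm
        _ ≤ 2 ^ (s * s * 8) := Nat.pow_le_pow_right two_pos (by nlinarith)
        _ = _ := pow_mul _ _ _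
    calc _ ≤ _ := h2
      _ ≤ 2 ^ (s * s) := (Nat.pow_le_pow_iff_left (by norm_num)).mp h3
      _ ≤ 2 ^ (2 * n) := Nat.pow_le_pow_right two_pos hle
      _ = 4 ^ n := by rw [pow_mul]; norm_num
  refine (Nat.pow_le_pow_iff_left (n := 3) (by norm_num)).mp ?_
  calc (n * (2 * n) ^ (s + 1) * 4 ^ (2 * n / 3)) ^ 3
      = (n * (2 * n) ^ (s + 1)) ^ 3 * 4 ^ (2 * n / 3 * 3) := by rw [mul_pow, ← pow_mul]
    _ ≤ 4 ^ n * 4 ^ (2 * n) := 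
        Nat.mul_le_mul h1 (Nat.pow_le_pow_right (by norm_num) (Nat.div_mul_le_self _ _))
    _ = (4 ^ n) ^ 3 := by rw [← pow_add, ← pow_mul]; congr 1; ring

/-- If `q` is the only prime in the interval `(n, 2n]`, the central binomial coefficient has
only `q` and primes at most `2n/3` as prime factors. -/
theorem centralBinom_le_of_unique_bertrand_prime (n q : ℕ) (hn : 2 < n) (hq : q ≤ 2 * n)
    (hqn : n < q)
    (huniq : ∀ p : ℕ, p.Prime → n < p → p ≤ 2 * n → p = q) :
    centralBinom n ≤ (2 * n) ^ (sqrt (2 * n) + 1) * 4 ^ (2 * n / 3) := by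
  let f x := x ^ n.centralBinom.factorization x
  have hprod : centralBinom n = f q * ∏ p ∈ Finset.range (2 * n / 3 + 1), f p := by
    rw [← Finset.prod_insert (by simp; lia)]
    refine (Eq.trans ?_ n.prod_pow_factorization_centralBinom).symm
    apply Finset.prod_subset
    · intro x hx
      simp only [Finset.mem_insert, Finset.mem_range] at hx ⊢
      lia
    intro x hx h2x
    simp only [Finset.mem_insert, Finset.mem_range, not_or] at hx h2x
    by_cases hxp : x.Prime
    · have hxn : x ≤ n := by
        by_contra! h
        exact h2x.1 (huniq x hxp h (by lia))
      simp only [f]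
      rw [factorization_centralBinom_of_two_mul_self_lt_three_mul hn hxn (by lia), Nat.pow_zero]
    · simp only [f]
      rw [factorization_eq_zero_of_not_prime n.centralBinom hxp, Nat.pow_zero]
  have n2_pos : 1 ≤ 2 * n := by lia
  have hfq : f q ≤ 2 * n := pow_factorization_choose_le (by lia)
  let S := {p ∈ Finset.range (2 * n / 3 + 1) | Nat.Prime p}
  have hS : ∏ x ∈ S, f x = ∏ x ∈ Finset.range (2 * n / 3 + 1), f x := by
    refine Finset.prod_filter_of_ne fun p _ h => ?_
    contrapose h
    simp only [f]
    rw [factorization_eq_zero_of_not_prime n.centralBinom h, Nat.pow_zero]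
  have hrest : ∏ x ∈ S, f x ≤ (2 * n) ^ sqrt (2 * n) * 4 ^ (2 * n / 3) := by
    rw [← Finset.prod_filter_mul_prod_filter_not S (· ≤ sqrt (2 * n))]
    apply mul_le_mul'
    · refine (Finset.prod_le_prod' fun p _ => (?_ : f p ≤ 2 * n)).trans ?_
      · exact pow_factorization_choose_le (by lia)
      have : (Finset.Icc 1 (sqrt (2 * n))).card = sqrt (2 * n) := by
        rw [card_Icc, Nat.add_sub_cancel]
      rw [Finset.prod_const]
      refine pow_right_mono₀ n2_pos ((Finset.card_le_card fun x hx => ?_).trans this.le)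
      obtain ⟨h1, h2⟩ := Finset.mem_filter.1 hx
      exact Finset.mem_Icc.mpr ⟨(Finset.mem_filter.1 h1).2.one_lt.le, h2⟩
    · refine le_trans ?_ (primorial_le_four_pow (2 * n / 3))
      refine (Finset.prod_le_prod' fun p hp => (?_ : f p ≤ p)).trans ?_
      · obtain ⟨h1, h2⟩ := Finset.mem_filter.1 hp
        refine (pow_right_mono₀ (Finset.mem_filter.1 h1).2.one_lt.le ?_).trans (pow_one p).le
        exact Nat.factorization_choose_le_one (sqrt_lt'.mp <| not_le.1 h2)
      refine Finset.prod_le_prod_of_subset_of_one_le' (Finset.filter_subset _ _) ?_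
      exact fun p hp _ => (Finset.mem_filter.1 hp).2.one_lt.le
  calc centralBinom n = f q * ∏ x ∈ S, f x := by rw [hS, ← hprod]
    _ ≤ 2 * n * ((2 * n) ^ sqrt (2 * n) * 4 ^ (2 * n / 3)) := Nat.mul_le_mul hfq hrest
    _ = _ := by ring

theorem exists_prime_lt_and_add_three_le_two_mul_of_large {m : ℕ} (hm : 968 ≤ m) :
    ∃ p, p.Prime ∧ m < p ∧ p + 3 ≤ 2 * m := by
  by_contra! h
  -- Of the candidates 2m - 2, 2m - 1, 2m that remain, only the middle one is odd.
  have huniq (p : ℕ) (hp : p.Prime) (hmp : m < p) (hpm : p ≤ 2 * m) : p = 2 * m - 1 := by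
    have h3 := h p hp hmp
    have hodd := hp.eq_two_or_odd'
    rcases hodd with h2 | ⟨k, hk⟩ <;> lia
  have hb := centralBinom_le_of_unique_bertrand_prime m (2 * m - 1) (by lia) (by lia) (by lia) huniq
  have h4 := Nat.four_pow_lt_mul_centralBinom m (by lia)
  have := mul_pow_sqrt_succ_mul_four_pow_le hm
  grw [hb, ← mul_assoc, this] at h4
  exact lt_irrefl _ h4

/-- A strengthening of Bertrand's postulate: for `n ≥ 8` there is a prime `p` with
`n / 2 < p ≤ n - 3`. -/
theorem exists_prime_two_mul_gt_and_add_three_le {n : ℕ} (hn : 8 ≤ n) :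
    ∃ p, p.Prime ∧ n < 2 * p ∧ p + 3 ≤ n := by
  rcases le_or_gt 1936 n with h | h
  · obtain ⟨p, hp, h1, h2⟩ :=
      exists_prime_lt_and_add_three_le_two_mul_of_large (m := n / 2) (by lia)
    exact ⟨p, hp, by lia, by lia⟩
  -- A prime p serves p + 3 ≤ n < 2p, so the ranges chain when each prime is at most twice its
  -- predecessor minus 3.
  by_cases h1 : n < 10
  · exact ⟨5, by norm_num, by lia, by lia⟩
  by_cases h2 : n < 14
  · exact ⟨7, by norm_num, by lia, by lia⟩
  by_cases h3 : n < 22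
  · exact ⟨11, by norm_num, by lia, by lia⟩
  by_cases h4 : n < 38
  · exact ⟨19, by norm_num, by lia, by lia⟩
  by_cases h5 : n < 62
  · exact ⟨31, by norm_num, by lia, by lia⟩
  by_cases h6 : n < 118
  · exact ⟨59, by norm_num, by lia, by lia⟩
  by_cases h7 : n < 226
  · exact ⟨113, by norm_num, by lia, by lia⟩
  by_cases h8 : n < 446
  · exact ⟨223, by norm_num, by lia, by lia⟩
  by_cases h9 : n < 886
  · exact ⟨443, by norm_num, by lia, by lia⟩
  by_cases h10 : n < 1766
  · exact ⟨883, by norm_num, by lia, by lia⟩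
  exact ⟨1753, by norm_num, by lia, by lia⟩

end Nat

/-! ### Ordered partitions. -/

section OrderedPartition

variable {α : Type*} [DecidableEq α]

theorem isOrderedPartition_cons_iff {S : Finset α} {a : ℕ} {l : List ℕ}
    {A : Fin (a :: l).length → Finset α} :
    IsOrderedPartition S (a :: l) A ↔
      A 0 ⊆ S ∧ (A 0).card = a ∧ IsOrderedPartition (S \ A 0) l (fun i => A i.succ) := by
  constructor
  · rintro ⟨hc, hd, hu⟩
    have hsub : ∀ i, A i ⊆ S := fun i => hu ▸ Finset.subset_biUnion_of_mem A (Finset.mem_univ i)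
    refine ⟨hsub 0, hc 0, fun i => hc i.succ, fun i j hij => hd _ _ (by simpa using hij), ?_⟩
    ext x
    simp only [Finset.mem_biUnion, Finset.mem_univ, true_and, Finset.mem_sdiff]
    constructor
    · rintro ⟨i, hi⟩
      exact ⟨hsub _ hi, Finset.disjoint_left.mp (hd i.succ 0 (Fin.succ_ne_zero i)) hi⟩
    · rintro ⟨hx, hx0⟩
      rw [← hu] at hx
      obtain ⟨i, -, hi⟩ := Finset.mem_biUnion.mp hx
      rcases Fin.eq_zero_or_eq_succ i with rfl | ⟨j, rfl⟩
      · exact absurd hi hx0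
      · exact ⟨j, hi⟩
  · rintro ⟨h0, hc0, hc, hd, hu⟩
    have hdis (i : Fin l.length) : Disjoint (A 0) (A i.succ) := by
      have : A i.succ ⊆ S \ A 0 :=
        hu ▸ Finset.subset_biUnion_of_mem (fun i : Fin l.length => A i.succ) (Finset.mem_univ i)
      exact Finset.disjoint_of_subset_right this Finset.disjoint_sdiff
    refine ⟨fun i => ?_, fun i j hij => ?_, ?_⟩
    · rcases Fin.eq_zero_or_eq_succ i with rfl | ⟨j, rfl⟩
      · exact hc0
      · exact hc j
    · rcases Fin.eq_zero_or_eq_succ i with rfl | ⟨i, rfl⟩ <;>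
        rcases Fin.eq_zero_or_eq_succ j with rfl | ⟨j, rfl⟩
      · exact absurd rfl hij
      · exact hdis j
      · exact (hdis i).symm
      · exact hd i j (by simpa using hij)
    · ext x
      simp only [Finset.mem_biUnion, Finset.mem_univ, true_and]
      have hux : x ∈ S \ A 0 ↔ ∃ i : Fin l.length, x ∈ A i.succ := by rw [← hu]; simp
      constructor
      · rintro ⟨i, hi⟩
        rcases Fin.eq_zero_or_eq_succ i with rfl | ⟨j, rfl⟩
        · exact h0 hi
        · exact (Finset.mem_sdiff.mp (hux.mpr ⟨j, hi⟩)).1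
      · intro hx
        by_cases hx0 : x ∈ A 0
        · exact ⟨0, hx0⟩
        · obtain ⟨i, hi⟩ := hux.mp (Finset.mem_sdiff.mpr ⟨hx, hx0⟩)
          exact ⟨i.succ, hi⟩

theorem exists_isOrderedPartition (l : List ℕ) (S : Finset α) (h : l.sum = S.card) :
    ∃ A, IsOrderedPartition S l A := by
  induction l generalizing S with
  | nil =>
    have : S = ∅ := by simpa using h.symm
    exact ⟨fun _ => ∅, fun i => i.elim0, fun i => i.elim0, by simp [this]⟩
  | cons a l ih =>
    obtain ⟨T, hT, hTc⟩ := Finset.exists_subset_card_eq (s := S) (n := a)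
      (by rw [List.sum_cons] at h; lia)
    obtain ⟨A, hA⟩ := ih (S \ T) (by rw [Finset.card_sdiff_of_subset hT, ← h]; simp [hTc])
    exact ⟨Fin.cons T A, isOrderedPartition_cons_iff.mpr ⟨hT, hTc, hA⟩⟩

theorem IsOrderedPartition.smul {S : Finset α} {l : List ℕ} {A : Fin l.length → Finset α}
    (hA : IsOrderedPartition S l A) (g : Equiv.Perm α) :
    IsOrderedPartition (g • S) l (fun i => g • A i) := by
  obtain ⟨hc, hd, hu⟩ := hA
  refine ⟨fun i => by rw [Finset.card_smul_finset, hc], fun i j hij => ?_, ?_⟩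
  · rw [Finset.disjoint_left]
    intro x hx hx'
    exact Finset.disjoint_left.mp (hd i j hij) (Finset.inv_smul_mem_iff.mpr hx)
      (Finset.inv_smul_mem_iff.mpr hx')
  · ext x
    simp [← hu, ← Finset.inv_smul_mem_iff]

end OrderedPartition

/-! ### λ-transitivity versus standardness at t. -/

theorem univ_sdiff_injective {n : ℕ} :
    Function.Injective (fun S : Finset (Fin n) => Finset.univ \ S) := fun S T h => by
  simpa using congrArg (Finset.univ \ ·) h

theorem smul_univ_sdiff {n : ℕ} (g : Equiv.Perm (Fin n)) (S : Finset (Fin n)) :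
    g • (Finset.univ \ S) = Finset.univ \ g • S := by
  ext x
  simp [← Finset.inv_smul_mem_iff]

variable {n : ℕ} {G : Subgroup (Equiv.Perm (Fin n))} {lam : n.Partition}

theorem Nat.Partition.sum_sortedParts (lam : n.Partition) : lam.sortedParts.sum = n := by
  rw [← Multiset.sum_coe, Nat.Partition.sortedParts, Multiset.sort_eq, lam.parts_sum]

theorem IsPartitionTransitive.isStandardAt {a : ℕ} {k : List ℕ}
    (hlam : lam.sortedParts = a :: k) (h : IsPartitionTransitive G lam) :
    IsStandardAt G lam (n - a) := by
  have hsum : a + k.sum = n := by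
    rw [← List.sum_cons, ← hlam, lam.sum_sortedParts]
  rw [IsPartitionTransitive, hlam] at h
  have hcard {S : Finset (Fin n)} (hS : S.card = n - a) : (Finset.univ \ S).card = a := by
    rw [Finset.card_sdiff_of_subset (Finset.subset_univ _), Finset.card_univ, Fintype.card_fin, hS]
    lia
  have hext {S : Finset (Fin n)} (hS : S.card = n - a) {A : Fin k.length → Finset (Fin n)}
      (hA : IsOrderedPartition S k A) : IsOrderedPartition Finset.univ (a :: k)
        (Fin.cons (Finset.univ \ S) A : Fin (k.length + 1) → Finset (Fin n)) := by
    refine isOrderedPartition_cons_iff.mpr ⟨Finset.subset_univ _, hcard hS, ?_⟩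
    simpa using hA
  have hmove {S T : Finset (Fin n)} (hS : S.card = n - a) (hT : T.card = n - a)
      {A B : Fin k.length → Finset (Fin n)} (hA : IsOrderedPartition S k A)
      (hB : IsOrderedPartition T k B) : ∃ g ∈ G, g • S = T ∧ ∀ i, g • A i = B i := by
    obtain ⟨g, hg, hgA⟩ := h _ _ (hext hS hA) (hext hT hB)
    refine ⟨g, hg, ?_, fun i => hgA i.succ⟩
    have h0 : g • (Finset.univ \ S) = Finset.univ \ T := hgA 0
    rw [smul_univ_sdiff] at h0
    exact univ_sdiff_injective h0
  refine ⟨fun S T hS hT => ?_, k, by rw [hlam]; congr 1; lia, fun T hT A B hA hB => ?_⟩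
  · obtain ⟨A, hA⟩ := exists_isOrderedPartition k S (by lia)
    obtain ⟨B, hB⟩ := exists_isOrderedPartition k T (by lia)
    obtain ⟨g, hg, hgS, -⟩ := hmove hS hT hA hB
    exact ⟨g, hg, hgS⟩
  · obtain ⟨g, hg, hgS, hgA⟩ := hmove hT hT hA hB
    exact ⟨g, ⟨hg, hgS⟩, hgA⟩

/-- First match the complements of the first parts by homogeneity, then correct inside the common
complement by its stabiliser. The bound `t ≤ n` only keeps `n - t` from truncating. -/
theorem IsStandardAt.isPartitionTransitive {t : ℕ} (h : IsStandardAt G lam t) (ht : t ≤ n) :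
    IsPartitionTransitive G lam := by
  obtain ⟨hhom, k, hk, hstab⟩ := h
  rw [IsPartitionTransitive, hk]
  intro A B hA hB
  obtain ⟨-, hA0, hA⟩ := isOrderedPartition_cons_iff.mp hA
  obtain ⟨-, hB0, hB⟩ := isOrderedPartition_cons_iff.mp hB
  have hcard {S : Finset (Fin n)} (hS : S.card = n - t) : (Finset.univ \ S).card = t := by
    rw [Finset.card_sdiff_of_subset (Finset.subset_univ _), Finset.card_univ, Fintype.card_fin, hS]
    lia
  obtain ⟨g, hg, hgA⟩ := hhom _ _ (hcard hA0) (hcard hB0)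
  have hA' := hA.smul g
  rw [hgA] at hA'
  obtain ⟨g', ⟨hg', hfix⟩, hg'A⟩ := hstab _ (hcard hB0) _ _ hA' hB
  refine ⟨g' * g, mul_mem hg' hg, fun i => ?_⟩
  rcases Fin.eq_zero_or_eq_succ i with rfl | ⟨i, rfl⟩
  · have hfix' : g' • (Finset.univ \ B 0) = Finset.univ \ B 0 := hfix
    rw [smul_univ_sdiff] at hfix' hgA
    rw [mul_smul, univ_sdiff_injective hgA]
    exact univ_sdiff_injective hfix'
  · rw [mul_smul]
    exact hg'A i

theorem Nat.Partition.exists_sortedParts_eq_cons (hlam : lam ≠ Nat.Partition.indiscrete n) :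
    ∃ (a : ℕ) (k : List ℕ), lam.sortedParts = a :: k ∧ 0 < a ∧ a < n ∧ ∀ b ∈ k, b ≤ a := by
  have hmem (x : ℕ) : x ∈ lam.sortedParts ↔ x ∈ lam.parts := Multiset.mem_sort _
  have hsum := lam.sum_sortedParts
  rcases hl : lam.sortedParts with _ | ⟨a, k⟩
  · obtain rfl : n = 0 := by simpa [hl] using hsum.symm
    exact absurd (Subsingleton.elim _ _) hlam
  · have ha : 0 < a := lam.parts_pos ((hmem a).mp (by simp [hl]))
    have hsort : lam.sortedParts.Pairwise (· ≥ ·) := Multiset.pairwise_sort _ _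
    rw [hl, List.pairwise_cons] at hsort
    rw [hl, List.sum_cons] at hsum
    refine ⟨a, k, rfl, ha, ?_, fun b hb => hsort.1 b hb⟩
    rcases k with _ | ⟨b, k⟩
    · refine absurd ?_ hlam
      have hparts : lam.parts = {a} := by
        rw [← Multiset.sort_eq lam.parts (· ≥ ·)]
        exact congrArg _ hl
      apply Nat.Partition.ext
      have hn : a = n := by simpa using hsum
      rw [Nat.Partition.indiscrete_parts (by lia), hparts, hn]
    · have hb : 0 < b := lam.parts_pos ((hmem b).mp (by simp [hl]))
      rw [List.sum_cons] at hsum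
      lia

/-- The p-group `zpowers x` acts on the cosets of `Q`, whose number is prime to p, so it fixes some
coset gQ. -/
theorem Subgroup.exists_conj_mem_of_not_dvd_index {Γ : Type*} [Group Γ] (Q : Subgroup Γ) {p : ℕ}
    (hp : p.Prime) (hQ : ¬ p ∣ Q.index) {x : Γ} (hx : orderOf x = p) :
    ∃ g : Γ, g⁻¹ * x * g ∈ Q := by
  have : Fact p.Prime := ⟨hp⟩
  have hP : IsPGroup p (Subgroup.zpowers x) :=
    IsPGroup.of_card (n := 1) (by rw [Nat.card_zpowers, hx, pow_one])
  obtain ⟨y, hy⟩ := hP.nonempty_fixed_point_of_prime_not_dvd_card (Γ ⧸ Q) hQ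
  obtain ⟨g, rfl⟩ := QuotientGroup.mk_surjective y
  refine ⟨g, ?_⟩
  have h := hy ⟨x, Subgroup.mem_zpowers x⟩
  have h' : ((x * g : Γ) : Γ ⧸ Q) = (g : Γ ⧸ Q) := h
  rw [eq_comm, QuotientGroup.eq] at h'
  rwa [mul_assoc]

/-! ### Jordan's theorem on cycles of prime length. -/

namespace Equiv.Perm

open MulAction

variable {α : Type*} [Fintype α] [DecidableEq α] {G : Subgroup (Perm α)}

theorem card_fixingSubgroup_compl (s : Finset α) :
    Nat.card (fixingSubgroup (Perm α) ((s : Set α)ᶜ)) = s.card.factorial := by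
  have e : fixingSubgroup (Perm α) ((s : Set α)ᶜ) ≃
      {f : Perm α // ∀ a, ¬ a ∈ s → f a = a} :=
    Equiv.subtypeEquivRight fun f => by simp [mem_fixingSubgroup_iff]
  rw [Nat.card_congr (e.trans (Perm.subtypeEquivSubtypePerm (· ∈ s)).symm), Nat.card_perm]
  simp

theorem isPreprimitive_fixingSubgroup_of_isCycle_mem {c : Perm α} (hc : c.IsCycle)
    (hp : c.support.card.Prime) (hcG : c ∈ G) :
    IsPreprimitive (fixingSubgroup G ((c.support : Set α)ᶜ))
      (SubMulAction.ofFixingSubgroup G ((c.support : Set α)ᶜ)) := by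
  have := isPretransitive_of_isCycle_mem hc hcG
  apply IsPreprimitive.of_prime_card
  convert! hp
  rw [← Set.ncard_coe_finset, ← Nat.card_coe_set_eq]
  exact Nat.card_congr (Equiv.subtypeEquivRight fun x => by
    simp [SubMulAction.mem_ofFixingSubgroup_iff])

/-- A transitive group containing a cycle of prime length greater than half the degree is
primitive. -/
theorem isPreprimitive_of_isCycle_mem [IsPretransitive G α] {c : Perm α} (hc : c.IsCycle)
    (hp : c.support.card.Prime) (hcG : c ∈ G) (hlt : Fintype.card α < 2 * c.support.card) :
    IsPreprimitive G α := by
  have := isPreprimitive_fixingSubgroup_of_isCycle_mem hc hp hcG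
  let f : SubMulAction.ofFixingSubgroup G ((c.support : Set α)ᶜ)
      →ₑ[(fixingSubgroup G ((c.support : Set α)ᶜ)).subtype] α :=
    ⟨Subtype.val, fun _ _ => rfl⟩
  -- A block containing the support has more than half the points, hence all of them. Otherwise
  -- every block meets the support in at most one point, so there are more than n/2 blocks and they
  -- are singletons.
  apply IsPreprimitive.of_card_lt (f := f)
  have hr : Set.range f = (c.support : Set α) := by
    change Set.range Subtype.val = _
    ext x
    simp [SubMulAction.mem_ofFixingSubgroup_iff]
  rw [hr, Set.ncard_coe_finset, Nat.card_eq_fintype_card]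
  exact hlt

/-- Frattini argument: the pointwise stabiliser H of the fixed points of `c` has order dividing p!,
so ⟨c⟩ is a Sylow p-subgroup of H. As `g` preserves the fixed points, `g * c * g⁻¹` lies in H, and
an element of H conjugates it back into ⟨c⟩ without changing `g` on those points. -/
theorem exists_mem_conj_mem_zpowers {c : Perm α} (hc : c.IsCycle) (hp : c.support.card.Prime)
    (hcG : c ∈ G) {g : Perm α} (hg : g ∈ G) (hsupp : ∀ a ∉ c.support, g a ∉ c.support)
    (hsupp' : ∀ a ∉ c.support, g⁻¹ a ∉ c.support) :
    ∃ h ∈ G, (∀ a ∉ c.support, h a = g a) ∧ h * c * h⁻¹ ∈ Subgroup.zpowers c := by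
  set p := c.support.card with hpc
  let H : Subgroup (Perm α) := G ⊓ fixingSubgroup (Perm α) ((c.support : Set α)ᶜ)
  have hmemH (f : Perm α) : f ∈ H ↔ f ∈ G ∧ ∀ a ∉ c.support, f a = a := by
    simp [H, mem_fixingSubgroup_iff]
  have hcH : c ∈ H := (hmemH c).mpr ⟨hcG, fun a ha => notMem_support.mp ha⟩
  have hxH : g * c * g⁻¹ ∈ H := by
    refine (hmemH _).mpr ⟨mul_mem (mul_mem hg hcG) (inv_mem hg), fun a ha => ?_⟩
    rw [mul_apply, mul_apply, notMem_support.mp (hsupp' a ha), show g (g⁻¹ a) = a from g.apply_symm_apply a]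
  let Q : Subgroup H := (Subgroup.zpowers c).subgroupOf H
  have hQ : ¬ p ∣ Q.index := by
    have hle : Subgroup.zpowers c ≤ H := by rwa [Subgroup.zpowers_le]
    have hcardQ : Nat.card Q = p := by
      rw [Nat.card_congr (Subgroup.subgroupOfEquivOfLe hle).toEquiv, Nat.card_zpowers, hc.orderOf]
    have hH : Nat.card H ∣ p.factorial := by
      rw [hpc, ← card_fixingSubgroup_compl]
      exact Subgroup.card_dvd_of_le inf_le_right
    rw [← Q.card_mul_index, hcardQ, ← Nat.mul_factorial_pred hp.ne_zero] at hH
    intro hdvd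
    have := hdvd.trans (Nat.dvd_of_mul_dvd_mul_left hp.pos hH)
    have := (hp.dvd_factorial).mp this
    have := hp.pos
    lia
  have hord : orderOf (⟨g * c * g⁻¹, hxH⟩ : H) = p := by
    rw [Subgroup.orderOf_mk, hpc, ← hc.orderOf]
    exact (SemiconjBy.orderOf_eq g (x := c) (by simp [SemiconjBy])).symm
  obtain ⟨h, hh⟩ := Q.exists_conj_mem_of_not_dvd_index hp hQ hord
  have hh' : (h : Perm α)⁻¹ * (g * c * g⁻¹) * h ∈ Subgroup.zpowers c := hh
  have hhH := (hmemH _).mp (inv_mem h.2)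
  refine ⟨(h : Perm α)⁻¹ * g, mul_mem hhH.1 hg, fun a ha => hhH.2 _ (hsupp a ha), ?_⟩
  convert hh' using 1
  group

theorem exists_mem_eq_swap_and_conj_mem_zpowers {c : Perm α} (hc : c.IsCycle)
    (hp : c.support.card.Prime) (hcG : c ∈ G)
    (hG : IsMultiplyPretransitive G α (Fintype.card α - c.support.card))
    {x y : α} (hx : x ∉ c.support) (hy : y ∉ c.support) :
    ∃ h ∈ G, (∀ a ∉ c.support, h a = swap x y a) ∧ h * c * h⁻¹ ∈ Subgroup.zpowers c := by
  have hswap {a : α} (ha : a ∉ c.support) : swap x y a ∉ c.support := by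
    rw [swap_apply_def]
    split_ifs <;> assumption
  have hcard : Fintype.card {a // a ∉ c.support} = Fintype.card α - c.support.card := by
    rw [← Finset.card_compl, Fintype.card_subtype]
    congr 1
    ext
    simp
  let e : Fin (Fintype.card α - c.support.card) ↪ α :=
    (Fintype.equivFinOfCardEq hcard).symm.toEmbedding.trans (Function.Embedding.subtype _)
  obtain ⟨⟨g, hg⟩, hge⟩ := exists_smul_eq G e (e.trans (swap x y).toEmbedding)
  have hgs : ∀ a ∉ c.support, g a = swap x y a := fun a ha => by
    have := DFunLike.congr_fun hge (Fintype.equivFinOfCardEq hcard ⟨a, ha⟩)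
    simpa [e] using this
  obtain ⟨h, hh, hhg, hhc⟩ := exists_mem_conj_mem_zpowers hc hp hcG hg
    (fun a ha => by rw [hgs a ha]; exact hswap ha) fun a ha => by
    have : g⁻¹ a = swap x y a := by
      rw [inv_eq_iff_eq, hgs _ (hswap ha), swap_apply_self]
    rw [this]
    exact hswap ha
  exact ⟨h, hh, fun a ha => (hhg a ha).trans (hgs a ha), hhc⟩

/-- If `u` and `v` normalize `⟨c⟩`, their commutator centralizes `c`. -/
theorem commute_inv_mul_of_conj_mem_zpowers {Γ : Type*} [Group Γ] {u v c : Γ}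
    (hu : u * c * u⁻¹ ∈ Subgroup.zpowers c) (hv : v * c * v⁻¹ ∈ Subgroup.zpowers c) :
    Commute ((v * u)⁻¹ * (u * v)) c := by
  obtain ⟨i, hi⟩ := hu
  obtain ⟨j, hj⟩ := hv
  simp only at hi hj
  -- Conjugation by `u` and `v` acts on ⟨c⟩ by power maps, which commute.
  have h1 : (u * v) * c * (u * v)⁻¹ = c ^ (i * j) := by
    rw [zpow_mul, hi, conj_zpow, hj]
    group
  have h2 : (v * u) * c * (v * u)⁻¹ = c ^ (i * j) := by
    rw [mul_comm i j, zpow_mul, hj, conj_zpow, hi]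
    group
  rw [← h2] at h1
  rw [mul_inv_eq_iff_eq_mul] at h1
  rw [Commute, SemiconjBy, mul_assoc, h1]
  group

/-- **Jordan's theorem**: a primitive group of degree at least `p + 3` containing a cycle of prime
length `p` contains the alternating group. -/
theorem alternatingGroup_le_of_isPreprimitive_of_isCycle_mem (hG : IsPreprimitive G α)
    {c : Perm α} (hc : c.IsCycle) (hp : c.support.card.Prime) (hcG : c ∈ G)
    (hcard : c.support.card + 3 ≤ Fintype.card α) : alternatingGroup α ≤ G := by
  -- The fixator of the n - p fixed points is primitive on the rest, so G is even (n - p + 1)-fold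
  -- transitive.
  have hmult : IsMultiplyPretransitive G α (Fintype.card α - c.support.card) := by
    obtain ⟨n, hn⟩ := Nat.exists_eq_add_of_le hcard
    have hsc : Set.ncard ((c.support : Set α)ᶜ) = n + 2 + 1 := by
      rw [← Finset.coe_compl, Set.ncard_coe_finset, Finset.card_compl]
      lia
    have h := hG.isMultiplyPreprimitive hsc
      (by rw [Nat.card_eq_fintype_card]; have := hp.two_le; lia)
      (isPreprimitive_fixingSubgroup_of_isCycle_mem hc hp hcG)
    have h' : IsMultiplyPretransitive G α (n + 2 + 2) :=
      IsMultiplyPreprimitive.isMultiplyPretransitive ..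
    exact isMultiplyPretransitive_of_le (n := n + 2 + 2) (by lia)
      (by rw [Nat.card_eq_fintype_card]; have := hp.two_le; lia)
  obtain ⟨x, hx, y, hy, z, hz, hxy, hxz, hyz⟩ : ∃ x ∈ c.supportᶜ, ∃ y ∈ c.supportᶜ,
      ∃ z ∈ c.supportᶜ, x ≠ y ∧ x ≠ z ∧ y ≠ z := by
    refine Finset.two_lt_card.mp ?_
    rw [Finset.card_compl]
    lia
  rw [Finset.mem_compl] at hx hy hz
  obtain ⟨u, huG, hu, huc⟩ := exists_mem_eq_swap_and_conj_mem_zpowers hc hp hcG hmult hx hy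
  obtain ⟨v, hvG, hv, hvc⟩ := exists_mem_eq_swap_and_conj_mem_zpowers hc hp hcG hmult hx hz
  -- The commutator centralises `c`, so on the support it is a power of `c`. Dividing that power out
  -- leaves the commutator of (x y) and (x z), the square of a 3-cycle.
  obtain ⟨hw, hwc⟩ := hc.commute_iff.mp (commute_inv_mul_of_conj_mem_zpowers huc hvc)
  set w := (v * u)⁻¹ * (u * v) with hwdef
  have hwG : w ∈ G := mul_mem (inv_mem (mul_mem hvG huG)) (mul_mem huG hvG)
  have hτG : (ofSubtype (subtypePerm w hw))⁻¹ * w ∈ G :=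
    mul_mem (inv_mem ((Subgroup.zpowers_le.mpr hcG) hwc)) hwG
  have hswap {x y a : α} (hx : x ∉ c.support) (hy : y ∉ c.support) (ha : a ∉ c.support) :
      swap x y a ∉ c.support := by
    rw [swap_apply_def]
    split_ifs <;> assumption
  have hτ : (ofSubtype (subtypePerm w hw))⁻¹ * w = (swap x y * swap x z) * (swap x y * swap x z) := by
    rw [inv_mul_eq_iff_eq_mul]
    ext a
    by_cases ha : a ∈ c.support
    · have h1 {b : α} (hb : b ∉ c.support) : a ≠ b := fun h => hb (h ▸ ha)
      simp only [mul_apply]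
      rw [swap_apply_of_ne_of_ne (h1 hx) (h1 hz), swap_apply_of_ne_of_ne (h1 hx) (h1 hy),
        swap_apply_of_ne_of_ne (h1 hx) (h1 hz), swap_apply_of_ne_of_ne (h1 hx) (h1 hy),
        ofSubtype_apply_of_mem _ ha, subtypePerm_apply]
    · have h1 := hswap hx hz ha
      have h2 := hswap hx hy h1
      have h3 := hswap hx hz h2
      have h4 := hswap hx hy h3
      simp only [mul_apply]
      rw [ofSubtype_apply_of_not_mem _ h4, hwdef, mul_apply, inv_eq_iff_eq, mul_apply, mul_apply,
        hv a ha, hu _ h1, hu _ h4, swap_apply_self, hv _ h3, swap_apply_self]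
  refine alternatingGroup_le_of_isPreprimitive_of_isThreeCycle_mem hG
    (isThreeCycle_swap_mul_swap_same hxy hxz hyz).isThreeCycle_sq ?_
  rwa [← hτ]

end Equiv.Perm

/-! ### Degree seven. -/

namespace Equiv.Perm

theorem formPerm_eq_of_support_card_eq_five {α : Type*} [Fintype α] [DecidableEq α] {d : Perm α}
    (hd : d.IsCycle) (h5 : d.support.card = 5) {x : α} (hx : x ∈ d.support) :
    ∃ b e f : α, [x, d x, b, e, f].Nodup ∧ d = List.formPerm [x, d x, b, e, f] := by
  have hcyc : d.cycleOf x = d := hd.cycleOf_eq (mem_support.mp hx)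
  have hlen : (toList d x).length = 5 := by rw [length_toList, hcyc, h5]
  have hform : List.formPerm (toList d x) = d := by rw [formPerm_toList, hcyc]
  have hnd := nodup_toList d x
  have h0 := getElem_toList d x 0 (by lia)
  have h1 := getElem_toList d x 1 (by lia)
  match h : toList d x, hlen with
  | [x', a, b, e, f], _ =>
    simp only [h] at h0 h1 hform hnd
    obtain rfl : x' = x := by simpa using h0
    obtain rfl : a = d x' := by simpa using h1
    exact ⟨b, e, f, hnd, hform.symm⟩

/-- With c the rotation and d the 5-cycle, the entries (i, j, k, l) encode words c^i d^j c^k d^l: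
squares of c d^j, and words with i + k = 6, j + l = 5. Every one of the 72 cases is served by some
word. -/
theorem exists_support_card_eq_three_addRight_formPerm :
    ∀ u ∈ [((0 : Fin 7), (1 : Fin 7)), (0, 2), (1, 2)], ∀ b, b ∉ [u.1, u.2, 6] →
      ∀ e, e ∉ [b, u.1, u.2, 6] → ∀ f : Fin 7, f ∉ [e, b, u.1, u.2, 6] →
      ∃ w ∈ [((1 : Fin 7), (1 : ℕ), (1 : Fin 7), (1 : ℕ)), (1, 2, 1, 2), (1, 3, 1, 3), (1, 4, 1, 4),
        (1, 1, 5, 4), (1, 2, 5, 3), (1, 3, 5, 2), (1, 4, 5, 1), (2, 1, 4, 4), (2, 2, 4, 3),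
        (2, 3, 4, 2), (2, 4, 4, 1), (3, 1, 3, 4), (3, 2, 3, 3)],
        ((Equiv.addRight w.1 : Perm (Fin 7)) * List.formPerm [u.1, u.2, b, e, f] ^ w.2.1 *
          (Equiv.addRight w.2.2.1 : Perm (Fin 7)) *
            List.formPerm [u.1, u.2, b, e, f] ^ w.2.2.2).support.card = 3 := by
  decide +kernel

theorem exists_support_card_eq_three_of_addRight_mem {G : Subgroup (Perm (Fin 7))}
    (hc : (Equiv.addRight 1 : Perm (Fin 7)) ∈ G) {d : Perm (Fin 7)} (hd : d.IsCycle)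
    (h5 : d.support.card = 5) (hdG : d ∈ G) (h6 : d 6 = 6) :
    ∃ w ∈ G, w.support.card = 3 := by
  have hadd (i : Fin 7) : (Equiv.addRight i : Perm (Fin 7)) ∈ G := by
    have : (Equiv.addRight 1 : Perm (Fin 7)) ^ (i : ℕ) = Equiv.addRight i := by
      revert i
      decide
    rw [← this]
    exact pow_mem hc _
  -- Besides 6, `d` fixes just one point, so it moves two of 0, 1, 2. Replacing `d` by a power that
  -- sends one to the other cuts down the cases.
  obtain ⟨u, hu, hx, hy⟩ : ∃ u ∈ [((0 : Fin 7), (1 : Fin 7)), (0, 2), (1, 2)],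
      u.1 ∈ d.support ∧ u.2 ∈ d.support := by
    by_contra! h
    have h01 := h (0, 1) (by simp)
    have h02 := h (0, 2) (by simp)
    have h12 := h (1, 2) (by simp)
    have h6' : (6 : Fin 7) ∉ d.support := by simpa using h6
    have : ∃ s : Finset (Fin 7), s.card = 3 ∧ ∀ i ∈ s, i ∉ d.support := by
      by_cases h0 : (0 : Fin 7) ∈ d.support
      · exact ⟨{1, 2, 6}, rfl, by simpa using ⟨by simpa using h01 h0, by simpa using h02 h0, h6⟩⟩
      · by_cases h1 : (1 : Fin 7) ∈ d.support
        · exact ⟨{0, 2, 6}, rfl, by simpa using ⟨by simpa using h0, by simpa using h12 h1, h6⟩⟩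
        · exact ⟨{0, 1, 6}, rfl, by simpa using ⟨by simpa using h0, by simpa using h1, h6⟩⟩
    obtain ⟨s, hs, hsd⟩ := this
    have hle := Finset.card_le_univ (s ∪ d.support)
    rw [Finset.card_union_of_disjoint (Finset.disjoint_left.mpr hsd), hs, h5,
      Fintype.card_fin] at hle
    lia
  obtain ⟨i, hi⟩ := hd.exists_pow_eq (mem_support.mp hx) (mem_support.mp hy)
  have hne : u.1 ≠ u.2 := by
    have : ∀ u ∈ [((0 : Fin 7), (1 : Fin 7)), (0, 2), (1, 2)], u.1 ≠ u.2 := by decide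
    exact this u hu
  have hord : orderOf (d ^ i) = 5 := by
    have : Fact (Nat.Prime 5) := ⟨by norm_num⟩
    refine orderOf_eq_prime ?_ fun h => hne ?_
    · rw [← pow_mul, mul_comm, pow_mul, ← h5, ← hd.orderOf, pow_orderOf_eq_one, one_pow]
    · rw [← hi, h, one_apply]
  have hsupp : (d ^ i).support ⊆ d.support := support_pow_le d i
  have hcyc : (d ^ i).IsCycle := isCycle_of_prime_order (by rw [hord]; norm_num)
    ((Finset.card_le_card hsupp).trans_lt (by rw [hord, h5]; norm_num))
  have h5' : (d ^ i).support.card = 5 := by rw [← hcyc.orderOf, hord]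
  obtain ⟨b, e, f, hnd, hform⟩ := formPerm_eq_of_support_card_eq_five hcyc h5'
    (x := u.1) (by rw [mem_support, hi]; exact hne.symm)
  have h6' {z : Fin 7} (hz : z ∈ [u.1, u.2, b, e, f]) : z ≠ 6 := by
    rintro rfl
    have hmem : (6 : Fin 7) ∈ (d ^ i).support := by
      rw [hform, List.support_formPerm_of_nodup _ hnd (by simp), hi]
      simpa using hz
    exact mem_support.mp (hsupp hmem) h6
  rw [hi] at hnd hform
  have hb := h6' (z := b) (by simp)
  have he := h6' (z := e) (by simp)
  have hf := h6' (z := f) (by simp)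
  simp only [List.nodup_cons, List.mem_cons, List.not_mem_nil, or_false, not_or,
    List.nodup_nil, and_true, not_false_eq_true] at hnd
  obtain ⟨w, -, hw⟩ := exists_support_card_eq_three_addRight_formPerm u hu b (by simp; tauto) e
    (by simp; tauto) f (by simp; tauto)
  rw [← hform] at hw
  have hdi : d ^ i ∈ G := pow_mem hdG i
  exact ⟨_, mul_mem (mul_mem (mul_mem (hadd _) (pow_mem hdi _)) (hadd _)) (pow_mem hdi _), hw⟩

/-- A permutation group of degree `7` containing a `7`-cycle and a `5`-cycle contains a
`3`-cycle. -/
theorem exists_isThreeCycle_mem_of_degree_seven {G : Subgroup (Perm (Fin 7))} {c d : Perm (Fin 7)}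
    (hc : c.IsCycle) (h7 : c.support.card = 7) (hcG : c ∈ G)
    (hd : d.IsCycle) (h5 : d.support.card = 5) (hdG : d ∈ G) :
    ∃ w ∈ G, w.IsThreeCycle := by
  have hrot : finRotate 7 = Equiv.addRight 1 := by ext i; simp
  obtain ⟨g, hg⟩ := isConj_iff.mp (hc.isConj (hrot ▸ isCycle_finRotate (n := 5))
    (h7.trans (by decide)) : IsConj c (Equiv.addRight 1))
  obtain ⟨z, hz⟩ : ∃ z, (g * d * g⁻¹) z = z := by
    by_contra! h
    have hall : (g * d * g⁻¹).support = Finset.univ := by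
      exact Finset.eq_univ_of_forall fun z => mem_support.mpr (h z)
    have := card_support_conj (σ := g) (τ := d)
    rw [hall, h5] at this
    simp at this
  -- A rotation carries the fixed point `z` to 6 and commutes with the rotation that `c` has become.
  let h : Perm (Fin 7) := Equiv.addRight (6 - z) * g
  have hhc : h * c * h⁻¹ = Equiv.addRight 1 := by
    have : h * c * h⁻¹ = Equiv.addRight (6 - z) * (g * c * g⁻¹) * (Equiv.addRight (6 - z))⁻¹ := by
      simp only [h]
      group
    rw [this, hg, mul_inv_eq_iff_eq_mul]
    refine Equiv.ext fun i => ?_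
    exact add_right_comm i 1 (6 - z)
  have hh6 : (h * d * h⁻¹) 6 = 6 := by
    have : h * d * h⁻¹ = Equiv.addRight (6 - z) * (g * d * g⁻¹) * (Equiv.addRight (6 - z))⁻¹ := by
      simp only [h]
      group
    have hz6 : (Equiv.addRight (6 - z) : Perm (Fin 7)) z = 6 := by simp
    have hz6' : (Equiv.addRight (6 - z) : Perm (Fin 7))⁻¹ 6 = z :=
      (Equiv.symm_apply_eq _).mpr hz6.symm
    rw [this, mul_apply, mul_apply, hz6', hz, hz6]
  have hmem {x : Perm (Fin 7)} (hx : x ∈ G) :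
      h * x * h⁻¹ ∈ G.map (MulAut.conj h).toMonoidHom := ⟨x, hx, rfl⟩
  obtain ⟨-, ⟨w, hw, rfl⟩, hw3⟩ := exists_support_card_eq_three_of_addRight_mem
    (hhc ▸ hmem hcG) (hd.conj (g := h)) (by rw [card_support_conj, h5]) (hmem hdG) hh6
  refine ⟨w, hw, card_support_eq_three_iff.mp ?_⟩
  rw [← hw3]
  exact (card_support_conj (σ := h) (τ := w)).symm

end Equiv.Perm

/-! ### Primes not dividing the index. -/

theorem Equiv.Perm.not_dvd_card_of_forall_smul_eq {α : Type*} [Fintype α] [DecidableEq α]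
    {l : List ℕ} {A : Fin l.length → Finset α} (hA : IsOrderedPartition Finset.univ l A) {p : ℕ}
    (hp : p.Prime) (hlt : ∀ b ∈ l, b < p) {Y : Subgroup (Equiv.Perm α)}
    (hY : ∀ y ∈ Y, ∀ i, y • A i = A i) : ¬ p ∣ Nat.card Y := by
  have : Fact p.Prime := ⟨hp⟩
  intro hdvd
  obtain ⟨⟨y, hyY⟩, hy⟩ := exists_prime_orderOf_dvd_card' p hdvd
  rw [Subgroup.orderOf_mk] at hy
  refine hp.one_lt.ne' (hy.symm.trans (orderOf_eq_one_iff.mpr (Equiv.ext fun x => ?_)))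
  obtain ⟨i, -, hx⟩ := Finset.mem_biUnion.mp (hA.2.2 ▸ Finset.mem_univ x)
  have hinv (z : α) : y z ∈ A i ↔ z ∈ A i := by
    have := Finset.smul_mem_smul_finset_iff y (b := z) (s := A i)
    rwa [hY y hyY i] at this
  -- On each part the order of `y` divides both p and |A i|!, which are coprime, so `y` is trivial.
  have h1 : orderOf (y.subtypePerm hinv) ∣ p := by
    refine orderOf_dvd_of_pow_eq_one ?_
    ext z
    rw [Equiv.Perm.subtypePerm_pow, Equiv.Perm.subtypePerm_apply]
    simp [← hy, pow_orderOf_eq_one]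
  have h2 : orderOf (y.subtypePerm hinv) ∣ (A i).card.factorial := by
    refine (orderOf_dvd_natCard _).trans (dvd_of_eq ?_)
    rw [Nat.card_perm]
    simp
  have h3 : ¬ p ∣ (A i).card.factorial := by
    rw [hp.dvd_factorial, not_le, hA.1 i]
    exact hlt _ (List.get_mem _ _)
  have h4 : orderOf (y.subtypePerm hinv) = 1 :=
    ((Nat.dvd_prime hp).mp h1).resolve_right fun h => h3 (h ▸ h2)
  have h5 := Equiv.congr_fun (orderOf_eq_one_iff.mp h4) ⟨x, hx⟩
  exact congrArg Subtype.val h5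

/-- Transitivity on the images of one ordered partition means S_n = YG for its stabiliser Y, so Y is
transitive on the cosets of `G` and the index divides |Y|. -/
theorem IsPartitionTransitive.not_dvd_index (h : IsPartitionTransitive G lam) {p : ℕ}
    (hp : p.Prime) (hlt : ∀ b ∈ lam.sortedParts, b < p) : ¬ p ∣ G.index := by
  obtain ⟨A, hA⟩ := exists_isOrderedPartition lam.sortedParts (Finset.univ : Finset (Fin n))
    (by rw [lam.sum_sortedParts, Finset.card_univ, Fintype.card_fin])
  let Y : Subgroup (Equiv.Perm (Fin n)) := ⨅ i, MulAction.stabilizer _ (A i)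
  have hmemY (y : Equiv.Perm (Fin n)) : y ∈ Y ↔ ∀ i, y • A i = A i := by
    simp [Y, Subgroup.mem_iInf]
  have htrans : MulAction.IsPretransitive Y (Equiv.Perm (Fin n) ⧸ G) := by
    refine (MulAction.isPretransitive_iff_base (QuotientGroup.mk 1)).mpr fun x => ?_
    obtain ⟨s, rfl⟩ := QuotientGroup.mk_surjective x
    have hs := hA.smul s⁻¹
    rw [Finset.smul_finset_univ] at hs
    obtain ⟨g, hg, hgA⟩ := h A _ hA hs
    have hy : s * g ∈ Y := (hmemY _).mpr fun i => by rw [mul_smul, hgA, smul_inv_smul]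
    refine ⟨⟨s * g, hy⟩, ?_⟩
    change ((s * g * 1 : Equiv.Perm (Fin n)) : Equiv.Perm (Fin n) ⧸ G) = s
    rw [QuotientGroup.eq]
    simpa using hg
  have hdvd : G.index ∣ Nat.card Y := by
    have := Subgroup.index_dvd_card
      (MulAction.stabilizer Y (QuotientGroup.mk 1 : Equiv.Perm (Fin n) ⧸ G))
    rwa [MulAction.index_stabilizer_of_transitive] at this
  exact fun hpG => Equiv.Perm.not_dvd_card_of_forall_smul_eq hA hp hlt
    (fun y hy => (hmemY y).mp hy) (hpG.trans hdvd)

theorem Equiv.Perm.exists_isCycle_mem_of_not_dvd_index {p : ℕ} (hp : p.Prime) (hpn : p ≤ n)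
    (hG : ¬ p ∣ G.index) : ∃ c ∈ G, c.IsCycle ∧ c.support.card = p := by
  obtain ⟨c, hc⟩ := (Equiv.Perm.exists_with_cycleType_iff (Fin n) (m := {p})).mpr
    ⟨by simpa using hpn, by simpa using hp.two_le⟩
  have hcyc : c.IsCycle := Equiv.Perm.card_cycleType_eq_one.mp (by rw [hc]; simp)
  have hcard : c.support.card = p := by rw [← Equiv.Perm.sum_cycleType, hc]; simp
  obtain ⟨g, hg⟩ := G.exists_conj_mem_of_not_dvd_index hp hG (x := c)
    (by rw [hcyc.orderOf, hcard])
  have hcyc' := hcyc.conj (g := g⁻¹)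
  have hcard' := card_support_conj (σ := g⁻¹) (τ := c)
  rw [inv_inv] at hcyc' hcard'
  exact ⟨_, hg, hcyc', hcard'.trans hcard⟩

/-! ### Groups containing the alternating group, and the conclusion. -/

/-- If the orbit O of `u` misses `v`, exchanging `u` for `v` in a t-set lowers its intersection with
O by one, while elements of `G` preserve that size. -/
theorem IsHomogeneousGroup.isPretransitive {t : ℕ} (h : IsHomogeneousGroup G t) (ht : 0 < t)
    (htn : t < n) : MulAction.IsPretransitive G (Fin n) := by
  refine ⟨fun u v => ?_⟩
  by_contra! hne
  have huv : u ≠ v := fun h => hne 1 (by rw [one_smul, h])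
  obtain ⟨S, huS, hSv, hS⟩ := Finset.exists_subsuperset_card_eq (s := {u}) (t := {v}ᶜ) (n := t)
    (by simpa using huv.symm) (by rw [Finset.card_singleton]; lia)
    (by rw [Finset.card_compl]; simp; lia)
  have huS' : u ∈ S := huS (Finset.mem_singleton_self u)
  have hvS : v ∉ S := fun hv => by simpa using hSv hv
  have hT : (insert v (S.erase u)).card = t := by
    rw [Finset.card_insert_of_notMem (fun h => hvS (Finset.mem_of_mem_erase h)),
      Finset.card_erase_of_mem huS', hS]
    lia
  obtain ⟨g, hg, hgS⟩ := h S _ hS hT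
  classical
  let O : Finset (Fin n) := Finset.univ.filter fun x => ∃ g : G, g • u = x
  have hO : g • O = O := by
    refine Finset.eq_of_subset_of_card_le (fun x hx => ?_) (by rw [Finset.card_smul_finset])
    obtain ⟨y, hy, rfl⟩ := Finset.mem_smul_finset.mp hx
    obtain ⟨k, hk⟩ := (Finset.mem_filter.mp hy).2
    refine Finset.mem_filter.mpr ⟨Finset.mem_univ _, ⟨g, hg⟩ * k, ?_⟩
    rw [mul_smul, hk]
    rfl
  have huO : u ∈ O := Finset.mem_filter.mpr ⟨Finset.mem_univ _, 1, one_smul _ _⟩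
  have hvO : v ∉ O := fun hv => by
    obtain ⟨k, hk⟩ := (Finset.mem_filter.mp hv).2
    exact hne k hk
  have hcard : (S ∩ O).card = (insert v (S.erase u) ∩ O).card := by
    rw [← hgS]
    nth_rewrite 2 [← hO]
    rw [← Finset.smul_finset_inter, Finset.card_smul_finset]
  rw [Finset.insert_inter_of_notMem hvO, Finset.erase_inter,
    Finset.card_erase_of_mem (Finset.mem_inter.mpr ⟨huS', huO⟩)] at hcard
  have := Finset.card_pos.mpr ⟨u, Finset.mem_inter.mpr ⟨huS', huO⟩⟩
  lia

/-- A group which is transitive on the ordered partitions of a type all of whose parts are at most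
half the degree contains the alternating group, apart from types with a part `3` in degree `6`. -/
theorem IsPartitionTransitive.alternatingGroup_le {a : ℕ} {k : List ℕ}
    (hlam : lam.sortedParts = a :: k) (hk : ∀ b ∈ k, b ≤ a) (ha : 0 < a) (h2a : 2 * a ≤ n)
    (h6 : n = 6 → a ≤ 2) (h : IsPartitionTransitive G lam) : alternatingGroup (Fin n) ≤ G := by
  have hcycle {p : ℕ} (hp : p.Prime) (hap : a < p) (hpn : p ≤ n) :
      ∃ c ∈ G, c.IsCycle ∧ c.support.card = p := by
    refine Equiv.Perm.exists_isCycle_mem_of_not_dvd_index hp hpn (h.not_dvd_index hp ?_)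
    intro b hb
    rw [hlam, List.mem_cons] at hb
    rcases hb with rfl | hb
    · exact hap
    · exact (hk b hb).trans_lt hap
  have := (h.isStandardAt hlam).1.isPretransitive (by lia) (by lia)
  have hprim {p : ℕ} (hp : p.Prime) (hpn : p ≤ n) (hnp : n < 2 * p) :
      MulAction.IsPreprimitive G (Fin n) := by
    obtain ⟨c, hc, hcyc, hcard⟩ := hcycle hp (by lia) hpn
    exact Equiv.Perm.isPreprimitive_of_isCycle_mem hcyc (by rwa [hcard]) hc
      (by rwa [hcard, Fintype.card_fin])
  have hthree (hG : MulAction.IsPreprimitive G (Fin n)) (ha2 : a ≤ 2) (hn : 3 ≤ n) :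
      alternatingGroup (Fin n) ≤ G := by
    obtain ⟨c, hc, -, hcard⟩ := hcycle Nat.prime_three (by lia) hn
    exact Equiv.Perm.alternatingGroup_le_of_isPreprimitive_of_isThreeCycle_mem hG
      (card_support_eq_three_iff.mp hcard) hc
  rcases le_or_gt 8 n with h8 | h8
  · obtain ⟨p, hp, hnp, hpn⟩ := Nat.exists_prime_two_mul_gt_and_add_three_le h8
    obtain ⟨c, hc, hcyc, hcard⟩ := hcycle hp (by lia) (by lia)
    exact Equiv.Perm.alternatingGroup_le_of_isPreprimitive_of_isCycle_mem
      (hprim hp (by lia) hnp) hcyc (by rwa [hcard]) hc (by rwa [hcard, Fintype.card_fin])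
  rcases lt_or_ge n 3 with h3 | h3
  · have hsub : alternatingGroup (Fin n) = ⊥ := 
      alternatingGroup.eq_bot_of_card_le_two (by rw [Nat.card_eq_fintype_card, Fintype.card_fin]; lia)
    rw [hsub]
    exact bot_le
  -- Here a ≤ 2 and 3 > n/2, so a 3-cycle serves both for primitivity and for the conclusion.
  rcases lt_or_ge n 6 with h5 | h5
  · exact hthree (hprim Nat.prime_three h3 (by lia)) (by lia) h3
  rcases (show n = 6 ∨ n = 7 by lia) with rfl | rfl
  · exact hthree (hprim Nat.prime_five (by lia) (by lia)) (h6 rfl) h3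
  · obtain ⟨c, hc, hcyc, hcard⟩ := hcycle (p := 7) (by norm_num) (by lia) le_rfl
    obtain ⟨d, hd, hdcyc, hdcard⟩ := hcycle (p := 5) (by norm_num) (by lia) (by lia)
    obtain ⟨w, hw, hw3⟩ := Equiv.Perm.exists_isThreeCycle_mem_of_degree_seven hcyc hcard hc
      hdcyc hdcard hd
    exact Equiv.Perm.alternatingGroup_le_of_isPreprimitive_of_isThreeCycle_mem
      (hprim Nat.prime_five (by lia) (by lia)) hw3 hw

theorem Equiv.Perm.eq_alternatingGroup_or_eq_top {α : Type*} [Fintype α] [DecidableEq α]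
    {G : Subgroup (Equiv.Perm α)} (h : alternatingGroup α ≤ G) : G = alternatingGroup α ∨ G = ⊤ := by
  by_cases htop : G ≤ alternatingGroup α
  · exact Or.inl (le_antisymm htop h)
  · right
    obtain ⟨s, hs, hsA⟩ := SetLike.not_le_iff_exists.mp htop
    refine eq_top_iff.mpr fun x _ => ?_
    by_cases hx : x ∈ alternatingGroup α
    · exact h hx
    · rw [Equiv.Perm.mem_alternatingGroup] at hx hsA
      have : x * s⁻¹ ∈ alternatingGroup α := by
        rw [Equiv.Perm.mem_alternatingGroup, map_mul, map_inv,
          (Int.units_eq_one_or _).resolve_left hx, (Int.units_eq_one_or _).resolve_left hsA]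
        simp
      simpa using mul_mem (h this) hs

theorem theorem1p2 (n : ℕ) (lam : n.Partition) (hlam : lam ≠ Nat.Partition.indiscrete n)
    (G : Subgroup (Equiv.Perm (Fin n)))
    (hA : G ≠ alternatingGroup (Fin n)) (hS : G ≠ ⊤) :
    (IsPartitionTransitive G lam ↔ IsStandard G lam) ∧
      (n ≠ 6 → (IsPartitionTransitive G lam ↔ IsStrictlyStandard G lam)) := by
  obtain ⟨a, k, hak, ha, han, hk⟩ := Nat.Partition.exists_sortedParts_eq_cons hlam
  have hbound (h : IsPartitionTransitive G lam) (h2a : 2 * a ≤ n) : n = 6 ∧ 2 < a := by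
    by_contra hcon
    rcases Equiv.Perm.eq_alternatingGroup_or_eq_top
      (h.alternatingGroup_le hak hk ha h2a (by lia)) with h' | h'
    · exact hA h'
    · exact hS h'
  refine ⟨⟨fun h => ⟨n - a, ?_, h.isStandardAt hak⟩, ?_⟩,
    fun h6 => ⟨fun h => ⟨n - a, ?_, h.isStandardAt hak⟩, ?_⟩⟩
  · by_contra! hlt
    have := hbound h (by lia)
    lia
  · rintro ⟨t, ht, hstd⟩
    exact hstd.isPartitionTransitive (by lia)
  · by_contra! hlt
    exact h6 (hbound h (by lia)).1
  · rintro ⟨t, ht, hstd⟩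
    exact hstd.isPartitionTransitive (by lia)
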